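/- Let $L^2=L^2(\mathbb T)$ and $L^\infty=L^\infty(\mathbb T)$ with respect to normalized Lebesgue measure on the unit circle $\mathbb T$, let $H^2\subset L^2$ be the Hardy space of all $f\in L^2$ whose Fourier coefficients of negative index vanish, and let $P$ be the orthogonal projection of $L^2$ onto $H^2$. A bounded operator on $H^2$ is a Toeplitz operator if it is of the form $T_\varphi f=P(\varphi f)$ for some $\varphi\in L^\infty$. For a tuple $\boldsymbol A=(A_1,\dots,A_d)$ of bounded operators on $H^2$ regard $\boldsymbol A$ as the operator $x\mapsto(A_1x,\dots,A_dx)$ from $H^2$ to the Hilbert direct sum of $d$ copies of $H^2$, with its operator norm, and put $$\operatorname{dist}(\boldsymbol A,\mathbb C^d\boldsymbol I)=\min_{z\in\mathbb C^d}\|(A_1-z_1I,\dots,A_d-z_dI)\|,\qquad \operatorname{var}_x(\boldsymbol A)=\|\boldsymbol Ax\|^2-\sum_{j=1}^d|\langle x, A_jx\rangle|^2 .$$ Then for every $d$ and every tuple $\boldsymbol A=(A_1,\dots,A_d)$ of Toeplitz operators on $H^2$, the minimum defining $\operatorname{dist}(\boldsymbol A,\mathbb C^d\boldsymbol I)$ is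 attained and $$\operatorname{dist}(\boldsymbol A,\mathbb C^d\boldsymbol I)^2=\sup_{\|x\|=1}\operatorname{var}_x(\boldsymbol A).$$ Such tuples need not commute: for every $d\ge 2$ there is a tuple $(A_1,\dots,A_d)$ of Toeplitz operators on $H^2$ with $A_iA_j\ne A_jA_i$ for some $i,j$. -/

import Mathlib

open MeasureTheory
open scoped ENNReal

noncomputable section

/-! ### Tuples of operators on a Hilbert space -/

section Tuples

variable {H : Type*} [NormedAddCommGroup H] [InnerProductSpace ℂ H] {d : ℕ}

/-- The tuple `(A₁, …, A_d)` as the bounded operator `x ↦ (A₁ x, …, A_d x)` from `H` to the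
Hilbert direct sum of `d` copies of `H`. Its norm is the operator norm. -/
def tupleOp (A : Fin d → H →L[ℂ] H) : H →L[ℂ] PiLp 2 (fun _ : Fin d => H) :=
  (PiLp.continuousLinearEquiv 2 ℂ (fun _ : Fin d => H)).symm.toContinuousLinearMap ∘L
    ContinuousLinearMap.pi A

/-- The tuple `z I = (z₁ I, …, z_d I)` of scalar operators. -/
def scalarTuple (H : Type*) [NormedAddCommGroup H] [InnerProductSpace ℂ H] {d : ℕ}
    (z : Fin d → ℂ) : Fin d → H →L[ℂ] H :=
  fun j => z j • ContinuousLinearMap.id ℂ H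

/-- `dist(A, ℂ^d I)`, the distance from the tuple `A` to the scalar tuples. -/
def distScalars (A : Fin d → H →L[ℂ] H) : ℝ :=
  ⨅ z : Fin d → ℂ, ‖tupleOp (A - scalarTuple H z)‖

/-- The variance `var_x(A) = ‖A x‖² - ∑ⱼ |⟨x, Aⱼ x⟩|²`. -/
def tupleVar (A : Fin d → H →L[ℂ] H) (x : H) : ℝ :=
  ‖tupleOp A x‖ ^ 2 - ∑ j, ‖inner ℂ x (A j x)‖ ^ 2

end Tuples

/-! ### The Hardy space of the circle and Toeplitz operators -/

/-- Normalized Lebesgue measure on the circle, parametrized by `t ∈ ℝ / ℤ` through `t ↦ exp(2πit)`. -/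
abbrev circleMeasure : Measure UnitAddCircle := AddCircle.haarAddCircle

/-- The space `L²` of the circle. -/
abbrev CircleL2 : Type := Lp ℂ 2 circleMeasure

/-- The space `L^∞` of the circle. -/
abbrev CircleLinfty : Type := Lp ℂ ∞ circleMeasure

/-- The Hardy space `H²`: the functions in `L²` of the circle all of whose Fourier coefficients
of negative index vanish. -/
def hardySpace : Submodule ℂ CircleL2 where
  carrier := {f | ∀ n : ℤ, n < 0 → fourierCoeff f n = 0}
  zero_mem' := fun n _ => by
    rw [← fourierBasis_repr]; simp
  add_mem' := fun {f g} hf hg n hn => by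
    have h1 := hf n hn
    have h2 := hg n hn
    rw [← fourierBasis_repr] at h1 h2 ⊢
    simp [h1, h2]
  smul_mem' := fun c f hf n hn => by
    have h1 := hf n hn
    rw [← fourierBasis_repr] at h1 ⊢
    simp [h1]

theorem isClosed_hardySpace : IsClosed (hardySpace : Set CircleL2) := by
  have h : (hardySpace : Set CircleL2) =
      ⋂ (n : ℤ) (_ : n < 0), {f : CircleL2 | inner ℂ (fourierBasis n : CircleL2) f = 0} := by
    ext f
    simp only [Set.mem_iInter, Set.mem_ofPred_eq]
    refine forall_congr' fun n => forall_congr' fun _ => ?_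
    rw [← fourierBasis_repr, HilbertBasis.repr_apply_apply]
  rw [h]
  exact isClosed_iInter fun n => isClosed_iInter fun _ =>
    isClosed_eq (continuous_const.inner continuous_id) continuous_const

instance instCompleteSpaceHardySpace : CompleteSpace hardySpace :=
  isClosed_hardySpace.completeSpace_coe

/-- Multiplication by `φ ∈ L^∞` as a bounded operator on `L²` of the circle. -/
def mulOp (φ : CircleLinfty) : CircleL2 →L[ℂ] CircleL2 :=
  (ContinuousLinearMap.mul ℂ ℂ).holderL circleMeasure ∞ 2 2 φ

/-- The Toeplitz operator `T_φ f = P (φ f)` on the Hardy space, where `P` is the orthogonal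
projection of `L²` onto `H²`. -/
def toeplitz (φ : CircleLinfty) : hardySpace →L[ℂ] hardySpace :=
  hardySpace.orthogonalProjectionOnto ∘L mulOp φ ∘L hardySpace.subtypeL

/-- An operator on the Hardy space is a Toeplitz operator if it is `T_φ` for some `φ ∈ L^∞`. -/
def IsToeplitz (A : hardySpace →L[ℂ] hardySpace) : Prop :=
  ∃ φ : CircleLinfty, A = toeplitz φ

end

/-!
Write `a(x)` for the vector with entries `⟨x, A_j x⟩`. For a unit vector `x`,
`‖(A - z) x‖² = var_x(A) + ‖a(x) - z‖²`, so `dist(A, ℂ^d I)²` is an upper bound for the variances.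

For the converse, let `V` be the supremum of the variances. Multiplication by `z ^ n` is an isometry
of the Hardy space that tends weakly to zero, and compressing a Toeplitz operator by it gives the
operator back. Hence `√s x + √t z ^ n y`, with `s + t = 1`, behaves for large `n` like an orthogonal
sum, and comparing its variance with `V` gives
`s var_x(A) + t var_y(A) + s t ‖a(x) - a(y)‖² ≤ V`
for all unit vectors `x` and `y`. With `s = t = 1/2` this shows that `a(x)` converges, to some `m`,
as `var_x(A)` tends to `V`. In the limit the inequality becomes `var_y(A) + s ‖m - a(y)‖² ≤ V`, and
`t → 0` gives `‖(A - m) y‖² ≤ V` for every unit vector `y`.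

The shift and its adjoint are Toeplitz operators that do not commute.
-/

section AlmostConcave

open Filter Set Topology

theorem exists_forall_add_dist_sq_le_of_isLUB {X E : Type*} [PseudoMetricSpace E] [CompleteSpace E]
    {v : X → ℝ} {c : X → E} {V : ℝ} (hV : IsLUB (range v) V)
    (hvc : ∀ x y, ∀ a b : ℝ, 0 ≤ a → 0 ≤ b → a + b = 1 →
      a * v x + b * v y + a * b * dist (c x) (c y) ^ 2 ≤ V) :
    ∃ m, ∀ y, v y + dist m (c y) ^ 2 ≤ V := by
  set F : Filter X := comap v (𝓝 V)
  have : F.NeBot := comap_neBot_iff_frequently.2 (hV.frequently_nhds_mem hV.nonempty)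
  have hv : Tendsto v F (𝓝 V) := tendsto_comap
  have hc : Cauchy (F.map c) := by
    rw [cauchy_map_iff', tendsto_uniformity_iff_dist_tendsto_zero]
    have hgap : Tendsto (fun p : X × X => √(2 * (V - v p.1) + 2 * (V - v p.2))) (F ×ˢ F) (𝓝 0) := by
      have hfst : Tendsto (fun p : X × X => v p.1) (F ×ˢ F) (𝓝 V) := hv.comp tendsto_fst
      have hsnd : Tendsto (fun p : X × X => v p.2) (F ×ˢ F) (𝓝 V) := hv.comp tendsto_snd
      simpa using (((hfst.const_sub V).const_mul 2).add ((hsnd.const_sub V).const_mul 2)).sqrt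
    refine squeeze_zero (fun _ => dist_nonneg) (fun p => Real.le_sqrt_of_sq_le ?_) hgap
    linarith [hvc p.1 p.2 (1 / 2) (1 / 2) (by norm_num) (by norm_num) (by norm_num)]
  obtain ⟨m, hm⟩ := CompleteSpace.complete hc
  refine ⟨m, fun y => ?_⟩
  have hscaled : ∀ t ∈ Ioc (0 : ℝ) 1, v y + (1 - t) * dist m (c y) ^ 2 ≤ V := fun t ht => by
    have hlim := le_of_tendsto' ((((hv.const_mul (1 - t)).add_const (t * v y)).add
      (((Tendsto.dist hm tendsto_const_nhds).pow 2).const_mul ((1 - t) * t)))) fun x =>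
      hvc x y (1 - t) t (by linarith [ht.2]) ht.1.le (by ring)
    refine le_of_mul_le_mul_left ?_ ht.1
    linarith
  have hcont : Continuous fun t : ℝ => v y + (1 - t) * dist m (c y) ^ 2 := by fun_prop
  refine le_of_tendsto (x := 𝓝[>] (0 : ℝ))
    (by simpa using (hcont.tendsto 0).mono_left nhdsWithin_le_nhds) ?_
  filter_upwards [Ioc_mem_nhdsGT zero_lt_one] with t ht using hscaled t ht

end AlmostConcave

section Hilbert

open Filter Topology

variable {𝕜 E ι : Type*} [RCLike 𝕜] [NormedAddCommGroup E] [InnerProductSpace 𝕜 E] {l : Filter ι}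

theorem norm_sub_smul_sq_of_norm_eq_one {x : E} (hx : ‖x‖ = 1) (y : E) (w : 𝕜) :
    ‖y - w • x‖ ^ 2 = ‖y‖ ^ 2 - ‖inner 𝕜 x y‖ ^ 2 + ‖inner 𝕜 x y - w‖ ^ 2 := by
  rw [@norm_sub_sq 𝕜, @norm_sub_sq 𝕜 𝕜, inner_smul_right, norm_smul, hx, mul_one,
    ← inner_conj_symm y x, RCLike.inner_apply]
  ring

theorem norm_smul_add_smul_sq_of_add_eq_one (x y : E) {a b : ℝ} (hab : a + b = 1) :
    ‖(a : 𝕜) • x + (b : 𝕜) • y‖ ^ 2 = a * ‖x‖ ^ 2 + b * ‖y‖ ^ 2 - a * b * ‖x - y‖ ^ 2 := by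
  obtain rfl : b = 1 - a := by linarith
  rw [@norm_add_sq 𝕜, @norm_sub_sq 𝕜, inner_smul_left, inner_smul_right, norm_smul, norm_smul,
    RCLike.norm_ofReal, RCLike.norm_ofReal, RCLike.conj_ofReal, ← mul_assoc, ← RCLike.ofReal_mul,
    RCLike.re_ofReal_mul, mul_pow, mul_pow, sq_abs, sq_abs]
  ring

theorem tendsto_inner_zero_of_topologicalClosure_span_eq_top {s : Set E} {w : ι → E} {C : ℝ}
    (hs : (Submodule.span 𝕜 s).topologicalClosure = ⊤) (hw : ∀ i, ‖w i‖ ≤ C)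
    (hsw : ∀ f ∈ s, Tendsto (fun i => inner 𝕜 f (w i)) l (𝓝 0)) (f : E) :
    Tendsto (fun i => inner 𝕜 f (w i)) l (𝓝 0) := by
  have hlip : ∀ i, LipschitzWith C.toNNReal fun f => inner 𝕜 f (w i) := fun i =>
    LipschitzWith.of_dist_le_mul fun f g => by
      rw [dist_eq_norm, dist_eq_norm, ← inner_sub_left, mul_comm]
      exact (norm_inner_le_norm _ _).trans
        (mul_le_mul_of_nonneg_left ((hw i).trans (Real.le_coe_toNNReal C)) (norm_nonneg _))
  have hclosed : IsClosed {f | Tendsto (fun i => inner 𝕜 f (w i)) l (𝓝 0)} :=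
    (LipschitzWith.uniformEquicontinuous _ _ hlip).equicontinuous.isClosed_setOfPred_tendsto
      continuous_const
  have hspan : ∀ f ∈ Submodule.span 𝕜 s, Tendsto (fun i => inner 𝕜 f (w i)) l (𝓝 0) :=
    fun f hf => by
      induction hf using Submodule.span_induction with
      | mem f hf => exact hsw f hf
      | zero => simpa using tendsto_const_nhds
      | add f g _ _ hf hg => simpa [inner_add_left] using hf.add hg
      | smul a f _ hf => simpa [inner_smul_left] using hf.const_mul _
  have hf : f ∈ (Submodule.span 𝕜 s).topologicalClosure := hs ▸ Submodule.mem_top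
  exact closure_minimal hspan hclosed hf

theorem tendsto_norm_add_sq_sub_norm_sq {x : E} {w : ι → E}
    (hxw : Tendsto (fun i => inner 𝕜 x (w i)) l (𝓝 0)) :
    Tendsto (fun i => ‖x + w i‖ ^ 2 - ‖w i‖ ^ 2) l (𝓝 (‖x‖ ^ 2)) := by
  have hre : Tendsto (fun i => RCLike.re (inner 𝕜 x (w i))) l (𝓝 0) := by
    simpa [Function.comp_def] using (RCLike.continuous_re.tendsto 0).comp hxw
  simp_rw [@norm_add_sq 𝕜, add_sub_cancel_right]
  simpa using (hre.const_mul 2).const_add (‖x‖ ^ 2)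

end Hilbert

section Tuples

open Filter Set Topology

variable {H : Type*} [NormedAddCommGroup H] [InnerProductSpace ℂ H] {d : ℕ}

/-- The mean `(⟨x, A₁ x⟩, …, ⟨x, A_d x⟩)` of the tuple `A` in the state `x`. It lives in Euclidean
space, so that `var_x(A) = ‖A x‖² - ‖mean‖²`. -/
noncomputable def tupleMean (A : Fin d → H →L[ℂ] H) (x : H) : EuclideanSpace ℂ (Fin d) :=
  WithLp.toLp 2 fun j => inner ℂ x (A j x)

theorem tupleVar_eq_sub_norm_tupleMean_sq (A : Fin d → H →L[ℂ] H) (x : H) :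
    tupleVar A x = ‖tupleOp A x‖ ^ 2 - ‖tupleMean A x‖ ^ 2 := by
  rw [EuclideanSpace.norm_sq_eq]
  rfl

theorem tupleMean_smul (A : Fin d → H →L[ℂ] H) (r : ℝ) (x : H) :
    tupleMean A ((r : ℂ) • x) = ((r ^ 2 : ℝ) : ℂ) • tupleMean A x := by
  ext j
  simp only [tupleMean, map_smul, inner_smul_left, inner_smul_right, Complex.conj_ofReal,
    PiLp.smul_apply, smul_eq_mul, Complex.ofReal_pow]
  ring

theorem norm_tupleOp_sub_scalarTuple_apply_sq (A : Fin d → H →L[ℂ] H) (z : Fin d → ℂ) {x : H}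
    (hx : ‖x‖ = 1) :
    ‖tupleOp (A - scalarTuple H z) x‖ ^ 2 =
      tupleVar A x + ‖tupleMean A x - WithLp.toLp 2 z‖ ^ 2 := by
  rw [tupleVar, PiLp.norm_sq_eq_of_L2, PiLp.norm_sq_eq_of_L2, EuclideanSpace.norm_sq_eq,
    ← Finset.sum_sub_distrib, ← Finset.sum_add_distrib]
  exact Finset.sum_congr rfl fun j _ => norm_sub_smul_sq_of_norm_eq_one hx (A j x) (z j)

theorem distScalars_nonneg (A : Fin d → H →L[ℂ] H) : 0 ≤ distScalars A :=
  Real.iInf_nonneg fun _ => ContinuousLinearMap.opNorm_nonneg _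

theorem distScalars_le (A : Fin d → H →L[ℂ] H) (z : Fin d → ℂ) :
    distScalars A ≤ ‖tupleOp (A - scalarTuple H z)‖ :=
  ciInf_le ⟨0, forall_mem_range.2 fun _ => ContinuousLinearMap.opNorm_nonneg _⟩ z

theorem tupleVar_le_distScalars_sq (A : Fin d → H →L[ℂ] H) {x : H} (hx : ‖x‖ = 1) :
    tupleVar A x ≤ distScalars A ^ 2 := by
  rw [← Real.sqrt_le_left (distScalars_nonneg A)]
  refine le_ciInf fun z => ?_
  rw [Real.sqrt_le_left (ContinuousLinearMap.opNorm_nonneg _)]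
  calc tupleVar A x ≤ ‖tupleOp (A - scalarTuple H z) x‖ ^ 2 := by
        rw [norm_tupleOp_sub_scalarTuple_apply_sq A z hx]
        exact le_add_of_nonneg_right (sq_nonneg _)
    _ ≤ ‖tupleOp (A - scalarTuple H z)‖ ^ 2 := by
        gcongr
        exact ContinuousLinearMap.unit_le_opNorm _ x hx.le

theorem norm_tupleOp_sq_mul_sub_norm_tupleMean_sq_le {A : Fin d → H →L[ℂ] H} {V : ℝ}
    (hV : ∀ x, ‖x‖ = 1 → tupleVar A x ≤ V) (u : H) :
    ‖tupleOp A u‖ ^ 2 * ‖u‖ ^ 2 - ‖tupleMean A u‖ ^ 2 ≤ V * (‖u‖ ^ 2) ^ 2 := by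
  rcases eq_or_ne u 0 with rfl | hu
  · simp
  obtain ⟨r, x, hr, hx, rfl⟩ : ∃ (r : ℝ) (x : H), 0 ≤ r ∧ ‖x‖ = 1 ∧ (r : ℂ) • x = u :=
    ⟨‖u‖, (‖u‖ : ℂ)⁻¹ • u, norm_nonneg u, norm_smul_inv_norm hu,
      smul_inv_smul₀ (by simpa using hu) u⟩
  have hvar := hV x hx
  rw [tupleVar_eq_sub_norm_tupleMean_sq] at hvar
  rw [map_smul, tupleMean_smul, norm_smul, norm_smul, norm_smul, hx]
  simp only [Complex.norm_real, Real.norm_eq_abs, abs_pow, abs_of_nonneg hr]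
  linarith [mul_le_mul_of_nonneg_left hvar (pow_nonneg hr 4)]

theorem exists_forall_norm_tupleOp_sub_scalarTuple_apply_sq_le {A : Fin d → H →L[ℂ] H} {V : ℝ}
    (hV : IsLUB {v : ℝ | ∃ x : H, ‖x‖ = 1 ∧ v = tupleVar A x} V)
    (hconc : ∀ x y : H, ‖x‖ = 1 → ‖y‖ = 1 → ∀ a b : ℝ, 0 ≤ a → 0 ≤ b → a + b = 1 →
      a * tupleVar A x + b * tupleVar A y + a * b * dist (tupleMean A x) (tupleMean A y) ^ 2 ≤ V) :
    ∃ z, ∀ y : H, ‖y‖ = 1 → ‖tupleOp (A - scalarTuple H z) y‖ ^ 2 ≤ V := by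
  have hrange : {v : ℝ | ∃ x : H, ‖x‖ = 1 ∧ v = tupleVar A x} =
      range fun x : {x : H // ‖x‖ = 1} => tupleVar A x := by
    ext v
    simp [eq_comm]
  obtain ⟨m, hm⟩ := exists_forall_add_dist_sq_le_of_isLUB (hrange ▸ hV)
    (c := fun x : {x : H // ‖x‖ = 1} => tupleMean A x) fun x y => hconc x y x.2 y.2
  refine ⟨m.ofLp, fun y hy => ?_⟩
  rw [norm_tupleOp_sub_scalarTuple_apply_sq A m.ofLp hy, WithLp.toLp_ofLp, norm_sub_rev,
    ← dist_eq_norm]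
  exact hm ⟨y, hy⟩

theorem distScalars_eq_and_sq_eq_of_forall_le {A : Fin d → H →L[ℂ] H} {V : ℝ} {z : Fin d → ℂ}
    (hV : IsLUB {v : ℝ | ∃ x : H, ‖x‖ = 1 ∧ v = tupleVar A x} V)
    (hz : ∀ y : H, ‖y‖ = 1 → ‖tupleOp (A - scalarTuple H z) y‖ ^ 2 ≤ V) :
    distScalars A = ‖tupleOp (A - scalarTuple H z)‖ ∧ distScalars A ^ 2 = V := by
  obtain ⟨_, x, hx, -⟩ := hV.nonempty
  have hV₀ : 0 ≤ V := (sq_nonneg _).trans (hz x hx)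
  have hnorm : ‖tupleOp (A - scalarTuple H z)‖ ≤ √V :=
    ContinuousLinearMap.opNorm_le_of_unit_norm (𝕜 := ℂ) (Real.sqrt_nonneg V) fun y hy =>
      Real.le_sqrt_of_sq_le (hz y hy)
  have hVdist : √V ≤ distScalars A := by
    rw [Real.sqrt_le_left (distScalars_nonneg A)]
    exact hV.2 (by rintro _ ⟨x, hx, rfl⟩; exact tupleVar_le_distScalars_sq A hx)
  have hdist : distScalars A = √V := ((distScalars_le A z).trans hnorm).antisymm hVdist
  exact ⟨(distScalars_le A z).antisymm (hnorm.trans hVdist), by rw [hdist, Real.sq_sqrt hV₀]⟩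

end Tuples

section Dilation

open Filter Topology

variable {H : Type*} [NormedAddCommGroup H] [InnerProductSpace ℂ H] {d : ℕ}

/-- A sequence of isometries `S n` of `H` that tends weakly to zero and satisfies
`(S n)* A_j (S n) = A_j` for each entry of the tuple `A`. When `S n` is the `n`-th power of the
unilateral shift, the second condition is the Brown–Halmos equation for Toeplitz operators. -/
structure IsWeaklyNullDilation (A : Fin d → H →L[ℂ] H) (S : ℕ → H →ₗᵢ[ℂ] H) : Prop where
  inner_map : ∀ n j x y, inner ℂ (S n x) (A j (S n y)) = inner ℂ x (A j y)
  tendsto_inner : ∀ x y, Tendsto (fun n => inner ℂ x (S n y)) atTop (𝓝 0)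

namespace IsWeaklyNullDilation

variable {A : Fin d → H →L[ℂ] H} {S : ℕ → H →ₗᵢ[ℂ] H}

theorem norm_apply_le (hS : IsWeaklyNullDilation A S) (n : ℕ) (j : Fin d) (y : H) :
    ‖A j y‖ ≤ ‖A j (S n y)‖ := by
  rcases eq_or_ne (A j y) 0 with hzero | hne
  · simp [hzero]
  refine le_of_mul_le_mul_left ?_ (norm_pos_iff.2 hne)
  calc ‖A j y‖ * ‖A j y‖ = ‖inner ℂ (S n (A j y)) (A j (S n y))‖ := by
        rw [hS.inner_map, inner_self_eq_norm_sq_to_K]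
        simp [sq]
    _ ≤ ‖S n (A j y)‖ * ‖A j (S n y)‖ := norm_inner_le_norm _ _
    _ = ‖A j y‖ * ‖A j (S n y)‖ := by rw [LinearIsometry.norm_map]

theorem norm_tupleOp_sq_le (hS : IsWeaklyNullDilation A S) (n : ℕ) (y : H) :
    ‖tupleOp A y‖ ^ 2 ≤ ‖tupleOp A (S n y)‖ ^ 2 := by
  rw [PiLp.norm_sq_eq_of_L2, PiLp.norm_sq_eq_of_L2]
  exact Finset.sum_le_sum fun j _ => pow_le_pow_left₀ (norm_nonneg _) (hS.norm_apply_le n j y) 2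

theorem tendsto_inner_swap (hS : IsWeaklyNullDilation A S) (x y : H) :
    Tendsto (fun n => inner ℂ (S n y) x) atTop (𝓝 0) := by
  simpa using (hS.tendsto_inner x y).star

variable [CompleteSpace H]

theorem tendsto_inner_apply {K : Type*} [NormedAddCommGroup K] [InnerProductSpace ℂ K]
    [CompleteSpace K] (hS : IsWeaklyNullDilation A S) (T : H →L[ℂ] K) (k : K) (y : H) :
    Tendsto (fun n => inner ℂ k (T (S n y))) atTop (𝓝 0) := by
  simpa only [ContinuousLinearMap.adjoint_inner_left] using hS.tendsto_inner (T.adjoint k) y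

theorem tendsto_tupleMean_add (hS : IsWeaklyNullDilation A S) (x y : H) :
    Tendsto (fun n => tupleMean A (x + S n y)) atTop (𝓝 (tupleMean A x + tupleMean A y)) := by
  refine ((PiLp.continuous_toLp 2 _).tendsto _).comp (tendsto_pi_nhds.2 fun j => ?_)
  have hcross := ((hS.tendsto_inner_apply (A j) x y).add
    (hS.tendsto_inner_swap (A j x) y)).const_add (inner ℂ x (A j x) + inner ℂ y (A j y))
  rw [add_zero, add_zero] at hcross
  refine hcross.congr fun n => ?_
  rw [map_add, inner_add_left, inner_add_right, inner_add_right, hS.inner_map]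
  ring

/-- In the limit, `x + S n y` behaves like the vector `x ⊕ y` of `H ⊕ H`, so a bound for the
variances of `A` also holds for the variances of `A ⊕ A`. -/
theorem add_mul_add_sub_norm_tupleMean_add_sq_le (hS : IsWeaklyNullDilation A S) {V : ℝ}
    (hV : ∀ x, ‖x‖ = 1 → tupleVar A x ≤ V) (x y : H) :
    (‖tupleOp A x‖ ^ 2 + ‖tupleOp A y‖ ^ 2) * (‖x‖ ^ 2 + ‖y‖ ^ 2) -
      ‖tupleMean A x + tupleMean A y‖ ^ 2 ≤ V * (‖x‖ ^ 2 + ‖y‖ ^ 2) ^ 2 := by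
  have hmean := (hS.tendsto_tupleMean_add x y).norm.pow 2
  have hnorm : Tendsto (fun n => ‖x + S n y‖ ^ 2) atTop (𝓝 (‖x‖ ^ 2 + ‖y‖ ^ 2)) := by
    refine ((tendsto_norm_add_sq_sub_norm_sq (hS.tendsto_inner x y)).add_const _).congr fun n => ?_
    rw [← (S n).norm_map y, sub_add_cancel]
  have himage : Tendsto
      (fun n => ‖tupleOp A (x + S n y)‖ ^ 2 - ‖tupleOp A (S n y)‖ ^ 2 + ‖tupleOp A y‖ ^ 2)
      atTop (𝓝 (‖tupleOp A x‖ ^ 2 + ‖tupleOp A y‖ ^ 2)) := by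
    simpa only [map_add] using (tendsto_norm_add_sq_sub_norm_sq
      (hS.tendsto_inner_apply (tupleOp A) (tupleOp A x) y)).add_const (‖tupleOp A y‖ ^ 2)
  refine le_of_tendsto_of_tendsto' ((himage.mul hnorm).sub hmean)
    ((hnorm.pow 2).const_mul V) fun n => ?_
  refine le_trans ?_ (norm_tupleOp_sq_mul_sub_norm_tupleMean_sq_le hV (x + S n y))
  gcongr
  linarith [hS.norm_tupleOp_sq_le n y]

theorem tupleVar_add_dist_tupleMean_sq_le (hS : IsWeaklyNullDilation A S) {V : ℝ}
    (hV : ∀ x, ‖x‖ = 1 → tupleVar A x ≤ V) {x y : H} (hx : ‖x‖ = 1) (hy : ‖y‖ = 1) {a b : ℝ}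
    (ha : 0 ≤ a) (hb : 0 ≤ b) (hab : a + b = 1) :
    a * tupleVar A x + b * tupleVar A y + a * b * dist (tupleMean A x) (tupleMean A y) ^ 2 ≤ V := by
  have hsqrt : ∀ c : ℝ, 0 ≤ c → ‖((√c : ℝ) : ℂ)‖ ^ 2 = c := fun c hc => by
    rw [Complex.norm_real, Real.norm_eq_abs, sq_abs, Real.sq_sqrt hc]
  have hsum := hS.add_mul_add_sub_norm_tupleMean_add_sq_le hV ((√a : ℂ) • x) ((√b : ℂ) • y)
  rw [map_smul, map_smul, tupleMean_smul, tupleMean_smul, norm_smul, norm_smul, norm_smul,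
    norm_smul, mul_pow, mul_pow, mul_pow, mul_pow, hsqrt a ha, hsqrt b hb, Real.sq_sqrt ha,
    Real.sq_sqrt hb, hx, hy, one_pow, mul_one, mul_one, hab, one_pow, mul_one, mul_one] at hsum
  have hconv := norm_smul_add_smul_sq_of_add_eq_one (𝕜 := ℂ) (tupleMean A x) (tupleMean A y) hab
  rw [RCLike.ofReal_eq_complex_ofReal] at hconv
  rw [tupleVar_eq_sub_norm_tupleMean_sq, tupleVar_eq_sub_norm_tupleMean_sq, dist_eq_norm]
  linarith

theorem exists_distScalars_eq_and_isLUB [Nontrivial H] (hS : IsWeaklyNullDilation A S) :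
    (∃ z : Fin d → ℂ, distScalars A = ‖tupleOp (A - scalarTuple H z)‖) ∧
      IsLUB {v : ℝ | ∃ x : H, ‖x‖ = 1 ∧ v = tupleVar A x} (distScalars A ^ 2) := by
  obtain ⟨x₀, hx₀⟩ := exists_norm_eq H zero_le_one
  have hbdd : BddAbove {v : ℝ | ∃ x : H, ‖x‖ = 1 ∧ v = tupleVar A x} :=
    ⟨distScalars A ^ 2, by rintro _ ⟨x, hx, rfl⟩; exact tupleVar_le_distScalars_sq A hx⟩
  have hne : {v : ℝ | ∃ x : H, ‖x‖ = 1 ∧ v = tupleVar A x}.Nonempty := ⟨_, x₀, hx₀, rfl⟩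
  have hV := isLUB_csSup hne hbdd
  obtain ⟨z, hz⟩ := exists_forall_norm_tupleOp_sub_scalarTuple_apply_sq_le hV
    fun x y hx hy a b => hS.tupleVar_add_dist_tupleMean_sq_le (fun x hx => hV.1 ⟨x, hx, rfl⟩) hx hy
  obtain ⟨hdist, hsq⟩ := distScalars_eq_and_sq_eq_of_forall_le hV hz
  exact ⟨⟨z, hdist⟩, hsq ▸ hV⟩

end IsWeaklyNullDilation

end Dilation

section Toeplitz

open Filter Topology

theorem coeFn_mulOp (φ : CircleLinfty) (f : CircleL2) :
    mulOp φ f =ᵐ[circleMeasure] fun t => φ t * f t :=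
  ContinuousLinearMap.coeFn_holder _ φ f

theorem mulOp_comm (φ ψ : CircleLinfty) (f : CircleL2) :
    mulOp φ (mulOp ψ f) = mulOp ψ (mulOp φ f) := by
  refine Lp.ext ?_
  filter_upwards [coeFn_mulOp φ (mulOp ψ f), coeFn_mulOp ψ (mulOp φ f), coeFn_mulOp φ f,
    coeFn_mulOp ψ f] with t hφψ hψφ hφ hψ
  rw [hφψ, hψφ, hφ, hψ, mul_left_comm]

theorem inner_mulOp_mulOp_of_norm_eq_one {φ : CircleLinfty} (hφ : ∀ᵐ t ∂circleMeasure, ‖φ t‖ = 1)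
    (f g : CircleL2) : inner ℂ (mulOp φ f) (mulOp φ g) = inner ℂ f g := by
  rw [L2.inner_def, L2.inner_def]
  refine integral_congr_ae ?_
  filter_upwards [coeFn_mulOp φ f, coeFn_mulOp φ g, hφ] with t hf hg ht
  have hunit : φ t * starRingEnd ℂ (φ t) = 1 := by simp [Complex.mul_conj', ht]
  rw [hf, hg, RCLike.inner_apply, RCLike.inner_apply, map_mul]
  linear_combination (g t * starRingEnd ℂ (f t)) * hunit

theorem norm_fourierLp_apply_ae (n : ℤ) :
    ∀ᵐ t ∂circleMeasure, ‖(fourierLp ∞ n : CircleLinfty) t‖ = 1 := by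
  filter_upwards [coeFn_fourierLp (T := 1) ∞ n] with t ht
  rw [ht, fourier_apply, Circle.norm_coe]

theorem inner_mulOp_fourierLp_mulOp_fourierLp (n : ℤ) (f g : CircleL2) :
    inner ℂ (mulOp (fourierLp ∞ n) f) (mulOp (fourierLp ∞ n) g) = inner ℂ f g :=
  inner_mulOp_mulOp_of_norm_eq_one (norm_fourierLp_apply_ae n) f g

theorem norm_mulOp_fourierLp (n : ℤ) (f : CircleL2) : ‖mulOp (fourierLp ∞ n) f‖ = ‖f‖ := by
  rw [@norm_eq_sqrt_re_inner ℂ, inner_mulOp_fourierLp_mulOp_fourierLp, ← @norm_eq_sqrt_re_inner ℂ]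

theorem mulOp_fourierLp_fourierLp (m n : ℤ) :
    mulOp (fourierLp ∞ m) (fourierLp 2 n) = fourierLp 2 (m + n) := by
  refine Lp.ext ?_
  filter_upwards [coeFn_mulOp (fourierLp ∞ m) (fourierLp 2 n), coeFn_fourierLp (T := 1) ∞ m,
    coeFn_fourierLp (T := 1) 2 n, coeFn_fourierLp (T := 1) 2 (m + n)] with t hmul hm hn hmn
  rw [hmul, hm, hn, hmn, fourier_add]

theorem inner_fourierLp_mulOp_fourierLp (k n : ℤ) (f : CircleL2) :
    inner ℂ (fourierLp 2 k) (mulOp (fourierLp ∞ n) f) = inner ℂ (fourierLp 2 (k - n)) f := by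
  rw [← inner_mulOp_fourierLp_mulOp_fourierLp n (fourierLp 2 (k - n)), mulOp_fourierLp_fourierLp,
    add_sub_cancel]

theorem tendsto_inner_mulOp_fourierLp (f g : CircleL2) :
    Tendsto (fun n : ℕ => inner ℂ f (mulOp (fourierLp ∞ n) g)) atTop (𝓝 0) := by
  have hcoeff : Tendsto (fun k : ℤ => inner ℂ (fourierLp 2 k) g) cofinite (𝓝 0) := by
    have hsq := (orthonormal_fourier.inner_products_summable (x := g)).tendsto_cofinite_zero
    rw [tendsto_zero_iff_norm_tendsto_zero]
    simpa using hsq.sqrt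
  refine tendsto_inner_zero_of_topologicalClosure_span_eq_top
    (w := fun n : ℕ => mulOp (fourierLp ∞ n) g)
    (span_fourierLp_closure_eq_top (T := 1) (p := 2) (by simp))
    (fun n => (norm_mulOp_fourierLp n g).le) ?_ f
  rintro _ ⟨k, rfl⟩
  simp_rw [inner_fourierLp_mulOp_fourierLp]
  refine hcoeff.comp ?_
  rw [← Nat.cofinite_eq_atTop]
  exact Function.Injective.tendsto_cofinite fun a b hab => by simpa using hab

theorem mem_hardySpace_iff (f : CircleL2) :
    f ∈ hardySpace ↔ ∀ n : ℤ, n < 0 → inner ℂ (fourierLp 2 n) f = 0 := by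
  have hcoeff : ∀ n : ℤ, fourierCoeff f n = inner ℂ (fourierLp 2 n) f := fun n => by
    rw [← fourierBasis_repr, HilbertBasis.repr_apply_apply, coe_fourierBasis]
  simp_rw [← hcoeff]
  rfl

theorem mulOp_fourierLp_mem_hardySpace (n : ℕ) {f : CircleL2} (hf : f ∈ hardySpace) :
    mulOp (fourierLp ∞ n) f ∈ hardySpace := by
  rw [mem_hardySpace_iff] at hf ⊢
  intro k hk
  rw [inner_fourierLp_mulOp_fourierLp]
  exact hf _ (by lia)

/-- The `n`-th power of the unilateral shift on the Hardy space, that is, multiplication by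
`z ^ n`. -/
noncomputable def hardyShift (n : ℕ) : hardySpace →ₗᵢ[ℂ] hardySpace where
  toLinearMap := (mulOp (fourierLp ∞ n)).toLinearMap.restrict
    fun _ => mulOp_fourierLp_mem_hardySpace n
  norm_map' f := norm_mulOp_fourierLp n f

theorem inner_toeplitz (φ : CircleLinfty) (f g : hardySpace) :
    inner ℂ f (toeplitz φ g) = inner ℂ (f : CircleL2) (mulOp φ g) :=
  hardySpace.inner_orthogonalProjectionOnto_eq_of_mem_left f (mulOp φ g)

theorem isWeaklyNullDilation_hardyShift {d : ℕ} {A : Fin d → hardySpace →L[ℂ] hardySpace}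
    (hA : ∀ j, IsToeplitz (A j)) : IsWeaklyNullDilation A hardyShift where
  inner_map n j f g := by
    obtain ⟨φ, hφ⟩ := hA j
    calc inner ℂ (hardyShift n f) (A j (hardyShift n g))
        = inner ℂ (mulOp (fourierLp ∞ n) f) (mulOp φ (mulOp (fourierLp ∞ n) g)) := by
          rw [hφ, inner_toeplitz]; rfl
      _ = inner ℂ f (A j g) := by
          rw [mulOp_comm, inner_mulOp_fourierLp_mulOp_fourierLp, hφ, inner_toeplitz]
  tendsto_inner f g := tendsto_inner_mulOp_fourierLp f g

/-- The monomial `z ^ n`, as an element of the Hardy space. -/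
noncomputable def hardyMonomial (n : ℕ) : hardySpace :=
  ⟨fourierLp 2 n, (mem_hardySpace_iff _).2 fun _ hk => orthonormal_fourier.2 (by lia)⟩

theorem hardyMonomial_ne_zero (n : ℕ) : hardyMonomial n ≠ 0 := fun h =>
  orthonormal_fourier.ne_zero (n : ℤ) (congrArg Subtype.val h)

instance instNontrivialHardySpace : Nontrivial hardySpace :=
  ⟨hardyMonomial 0, 0, hardyMonomial_ne_zero 0⟩

theorem toeplitz_fourierLp_hardyMonomial_eq_projection (m : ℤ) (n : ℕ) :
    toeplitz (fourierLp ∞ m) (hardyMonomial n) =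
      hardySpace.orthogonalProjectionOnto (fourierLp 2 (m + n)) :=
  congrArg hardySpace.orthogonalProjectionOnto (mulOp_fourierLp_fourierLp m n)

theorem toeplitz_fourierLp_hardyMonomial {m : ℤ} {n k : ℕ} (h : m + n = k) :
    toeplitz (fourierLp ∞ m) (hardyMonomial n) = hardyMonomial k := by
  rw [toeplitz_fourierLp_hardyMonomial_eq_projection, h]
  exact hardySpace.orthogonalProjectionOnto_mem_subspace_eq_self (hardyMonomial k)

theorem toeplitz_fourierLp_hardyMonomial_eq_zero {m : ℤ} {n : ℕ} (h : m + n < 0) :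
    toeplitz (fourierLp ∞ m) (hardyMonomial n) = 0 := by
  rw [toeplitz_fourierLp_hardyMonomial_eq_projection]
  refine hardySpace.orthogonalProjectionOnto_apply_of_mem_orthogonal ?_
  rw [Submodule.mem_orthogonal']
  exact fun f hf => (mem_hardySpace_iff f).1 hf _ h

theorem toeplitz_fourierLp_one_mul_neg_one_ne :
    toeplitz (fourierLp ∞ 1) * toeplitz (fourierLp ∞ (-1)) ≠
      toeplitz (fourierLp ∞ (-1)) * toeplitz (fourierLp ∞ 1) := fun h => by
  have happly := DFunLike.congr_fun h (hardyMonomial 0)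
  rw [mul_apply_eq_comp, mul_apply_eq_comp,
    toeplitz_fourierLp_hardyMonomial_eq_zero (by norm_num), map_zero,
    toeplitz_fourierLp_hardyMonomial (k := 1) (by norm_num),
    toeplitz_fourierLp_hardyMonomial (k := 0) (by norm_num)] at happly
  exact hardyMonomial_ne_zero 0 happly.symm

end Toeplitz

theorem corollary10 :
    (∀ (d : ℕ) (A : Fin d → hardySpace →L[ℂ] hardySpace), (∀ j, IsToeplitz (A j)) →
      (∃ z : Fin d → ℂ, distScalars A = ‖tupleOp (A - scalarTuple hardySpace z)‖) ∧
      IsLUB {v : ℝ | ∃ x : hardySpace, ‖x‖ = 1 ∧ v = tupleVar A x} (distScalars A ^ 2)) ∧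
    (∀ d : ℕ, 2 ≤ d → ∃ A : Fin d → hardySpace →L[ℂ] hardySpace,
      (∀ j, IsToeplitz (A j)) ∧ ∃ i j, A i * A j ≠ A j * A i) := by
  refine ⟨fun d A hA => (isWeaklyNullDilation_hardyShift hA).exists_distScalars_eq_and_isLUB,
    fun d hd => ?_⟩
  let A : Fin d → hardySpace →L[ℂ] hardySpace :=
    fun j => toeplitz (fourierLp ∞ (if (j : ℕ) = 0 then 1 else -1))
  refine ⟨A, fun j => ⟨_, rfl⟩, ⟨0, by lia⟩, ⟨1, by lia⟩, ?_⟩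
  simpa [A] using toeplitz_fourierLp_one_mul_neg_one_ne
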